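/- Let $k$ be an integer such that $k-1$ is a prime power. For a finite simple graph $G$ on $n\ge 1$ vertices whose adjacency matrix has eigenvalues $\lambda_1\ge\cdots\ge\lambda_n$, let $R(G)=\max\{|\lambda_{\lfloor (n+1)/2\rfloor}|,|\lambda_{\lceil (n+1)/2\rceil}|\}$ be its HL-index. For an edge $ab$ of $G$ and $t\ge 1$, the cyclic $t$-lift of $G$ over the edge $ab$ is the graph with vertex set $V(G)\times\mathbb{Z}/t$ in which, for every edge $uv\ne ab$ of $G$, $(u,i)$ is adjacent to $(v,i)$ for all $i$, while $(a,i)$ is adjacent to $(b,i+1)$ for all $i$ (and there are no further edges). Then there are infinitely many pairwise non-isomorphic finite simple connected bipartite $k$-regular graphs $G$ with $$\sqrt{k-2}-1<R(G)<\sqrt{k-1}-1,$$ each of which is a cyclic lift over one edge of the incidence graph of a projective plane of order $k-1$. In fact, for every projective plane of order $k-1$, every edge $ab$ of its incidence graph and every $t\ge 1$, the cyclic $2t$-lift of the incidence graph over $ab$ is a connected bipartite $k$-regular graph satisfying these inequalities. -/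

import Mathlib

/-- The `i`-th largest eigenvalue (`1 ≤ i ≤ |V|`, counted with multiplicity) of the adjacency
matrix of a finite simple graph; the value is `0` for other `i`. -/
noncomputable def graphEigenvalue {V : Type*} [Fintype V] (G : SimpleGraph V) (i : ℕ) : ℝ :=
  open Classical in
  if h : i - 1 < Fintype.card V ∧ 1 ≤ i then
    (show (G.adjMatrix ℝ).IsHermitian from G.isHermitian_adjMatrix ℝ).eigenvalues₀ ⟨i - 1, h.1⟩
  else 0

/-- The HL-index `max (|λ_⌊(n+1)/2⌋|, |λ_⌈(n+1)/2⌉|)` of a graph on `n` vertices. -/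
noncomputable def hlIndex {V : Type*} [Fintype V] (G : SimpleGraph V) : ℝ :=
  max |graphEigenvalue G ⌊((Fintype.card V : ℚ) + 1) / 2⌋₊|
    |graphEigenvalue G ⌈((Fintype.card V : ℚ) + 1) / 2⌉₊|

/-- Every vertex of a finite graph has exactly `k` neighbours. -/
def IsKRegular {V : Type*} [Fintype V] (G : SimpleGraph V) (k : ℕ) : Prop :=
  open Classical in G.IsRegularOfDegree k

/-- A permutation voltage assignment with values in the permutations of `t` points; only the
values on ordered pairs of adjacent vertices matter. -/
structure VoltageAssignment {V : Type*} (G : SimpleGraph V) (t : ℕ) where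
  /-- The permutation attached to the edge oriented from the first vertex to the second. -/
  perm : V → V → Equiv.Perm (Fin t)
  perm_rev : ∀ u v, G.Adj u v → perm v u = (perm u v)⁻¹

/-- The `t`-lift of `G` associated to a permutation voltage assignment: the block of its adjacency
matrix at an edge `uv` of `G` is the permutation matrix of the voltage from `u` to `v`. -/
def VoltageAssignment.lift {V : Type*} {G : SimpleGraph V} {t : ℕ}
    (φ : VoltageAssignment G t) : SimpleGraph (V × Fin t) where
  Adj x y := G.Adj x.1 y.1 ∧ φ.perm x.1 y.1 x.2 = y.2
  symm := ⟨by
    rintro ⟨u, i⟩ ⟨v, j⟩ ⟨h, e⟩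
    refine ⟨h.symm, ?_⟩
    change φ.perm v u j = i
    change φ.perm u v i = j at e
    rw [φ.perm_rev u v h, ← e]
    exact (φ.perm u v).symm_apply_apply i⟩
  loopless := ⟨fun x h => G.loopless.irrefl x.1 h.1⟩

/-- The voltage assignment that is the cyclic permutation of `t` points on the edge oriented from
`a` to `b`, its inverse on the opposite orientation, and the identity on all other edges. -/
noncomputable def cyclicVoltage {V : Type*} (G : SimpleGraph V) (a b : V) (hab : G.Adj a b)
    (t : ℕ) : VoltageAssignment G t where
  perm u v :=
    open Classical in
    if u = a ∧ v = b then finRotate t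
    else if u = b ∧ v = a then (finRotate t)⁻¹
    else 1
  perm_rev := by
    intro u v _
    have hne : a ≠ b := hab.ne
    by_cases h1 : u = a ∧ v = b
    · obtain ⟨rfl, rfl⟩ := h1
      simp [hne, hne.symm]
    · by_cases h2 : u = b ∧ v = a
      · obtain ⟨rfl, rfl⟩ := h2
        simp [hne, hne.symm]
      · have h3 : ¬ (v = a ∧ u = b) := fun h => h2 ⟨h.2, h.1⟩
        have h4 : ¬ (v = b ∧ u = a) := fun h => h1 ⟨h.2, h.1⟩
        simp only [h1, h2, h3, h4, if_false, inv_one]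

/-- The cyclic `t`-lift of `G` over the single edge `ab`. -/
noncomputable def cyclicLift {V : Type*} (G : SimpleGraph V) (a b : V) (hab : G.Adj a b) (t : ℕ) :
    SimpleGraph (V × Fin t) :=
  (cyclicVoltage G a b hab t).lift

/-- The incidence graph of a point-line geometry: a point and a line are adjacent exactly when
they are incident. -/
def incidenceGraph (P L : Type*) [Membership P L] : SimpleGraph (P ⊕ L) where
  Adj x y := (∃ p l, x = Sum.inl p ∧ y = Sum.inr l ∧ p ∈ l) ∨
    (∃ p l, x = Sum.inr l ∧ y = Sum.inl p ∧ p ∈ l)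
  symm := ⟨by
    rintro x y (⟨p, l, hx, hy, h⟩ | ⟨p, l, hx, hy, h⟩)
    · exact Or.inr ⟨p, l, hy, hx, h⟩
    · exact Or.inl ⟨p, l, hy, hx, h⟩⟩
  loopless := ⟨by
    rintro x (⟨p, l, hx, hy, _⟩ | ⟨p, l, hx, hy, _⟩) <;> simp [hx] at hy⟩

/-- A connected bipartite `k`-regular graph whose HL-index lies strictly between `√(k-2) - 1` and
`√(k-1) - 1`. -/
def HasLargeHLIndex {V : Type*} [Fintype V] (G : SimpleGraph V) (k : ℕ) : Prop :=
  G.Connected ∧ G.IsBipartite ∧ IsKRegular G k ∧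
    Real.sqrt ((k : ℝ) - 2) - 1 < hlIndex G ∧ hlIndex G < Real.sqrt ((k : ℝ) - 1) - 1

/-- `G` is isomorphic to a cyclic lift over one edge of the incidence graph of some finite
projective plane of order `q`. -/
def IsCyclicLiftOfPlane {V : Type*} (G : SimpleGraph V) (q : ℕ) : Prop :=
  ∃ (P L : Type) (_ : Fintype P) (_ : Fintype L) (_ : Membership P L)
    (_ : Configuration.ProjectivePlane P L) (a b : P ⊕ L) (hab : (incidenceGraph P L).Adj a b)
    (t : ℕ), Configuration.ProjectivePlane.order P L = q ∧ 1 ≤ t ∧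
      Nonempty (G ≃g cyclicLift (incidenceGraph P L) a b hab t)

/-! Let `q = k - 1`, let `A` be the adjacency operator of the incidence graph, and let the voltage
`σ` sit on the flag `(p, l)`. On each sheet, an eigenfunction of the lift with eigenvalue `x` solves
`(x - A) f = α e_p + β e_l`, where `α` and `β` are the jumps of its values at `l` and `p` between
neighbouring sheets. Since `N Nᵀ = q I + J`, for `x² < q` the resolvent of `A` is explicit, with
diagonal entry `ρ` and flag entry `τ`. Eliminating the values at `l` leaves `u + κ Δu = 0` for the
values `u` at `p`, where `Δ = 2 - σ - σ⁻¹` and `κ = τ + τ² - ρ²`.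

As `0 ≤ Δ ≤ 4`, only `u = 0` is possible when `1 + 4κ > 0`. The number `1 + 4κ` is a positive
multiple of `signedFlagPoly q x * signedFlagPoly q (-x)`, and this cubic is positive for `|x| ≤
√(q-1) - 1`, so no eigenvalue lies there. On an even cycle the alternating sign attains `Δ = 4`, so
a root of the cubic in `(0, √q - 1)` is an eigenvalue. The lift is bipartite of even order, so its
two median eigenvalues are opposite and the HL-index is the least absolute value of an eigenvalue.
-/

/-! ### Adjacency eigenvalues and the HL-index of a bipartite graph -/

/-- `x` is an eigenvalue of the adjacency operator of the finite graph `G`. -/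
def IsAdjEigenvalue {V : Type*} [Fintype V] (G : SimpleGraph V) (x : ℝ) : Prop :=
  open Classical in
  ∃ f : V → ℝ, f ≠ 0 ∧ ∀ v, ∑ w, (if G.Adj v w then f w else 0) = x * f v

theorem IsAdjEigenvalue.of_iso {V W : Type*} [Fintype V] [Fintype W] {G : SimpleGraph V}
    {H : SimpleGraph W} (e : G ≃g H) {x : ℝ} (h : IsAdjEigenvalue G x) : IsAdjEigenvalue H x := by
  classical
  obtain ⟨f, hf, h⟩ := h
  refine ⟨fun w => f (e.symm w), fun h0 => hf ?_, fun w => ?_⟩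
  · ext v
    simpa using congrFun h0 (e v)
  · rw [← h (e.symm w)]
    refine (Fintype.sum_equiv e.toEquiv _ _ fun v => ?_).symm
    have : H.Adj w (e v) ↔ G.Adj (e.symm w) v := by
      rw [← e.map_adj_iff, RelIso.apply_symm_apply]
    simp [this]

theorem isAdjEigenvalue_iff_mem_range_eigenvalues₀ {V : Type*} [Fintype V] [DecidableEq V]
    (G : SimpleGraph V) [DecidableRel G.Adj] (hA : (G.adjMatrix ℝ).IsHermitian) (x : ℝ) :
    IsAdjEigenvalue G x ↔ ∃ i, hA.eigenvalues₀ i = x := by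
  have h1 : (∃ i, hA.eigenvalues₀ i = x) ↔ x ∈ spectrum ℝ (G.adjMatrix ℝ) := by
    rw [hA.spectrum_real_eq_range_eigenvalues]
    constructor
    · rintro ⟨i, rfl⟩
      exact ⟨Fintype.equivOfCardEq (Fintype.card_fin _) i, by simp [Matrix.IsHermitian.eigenvalues]⟩
    · rintro ⟨v, rfl⟩
      exact ⟨_, rfl⟩
  rw [h1, ← Matrix.spectrum_toLin', ← Module.End.hasEigenvalue_iff_mem_spectrum]
  have key : ∀ f : V → ℝ, (G.adjMatrix ℝ).toLin' f = x • f ↔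
      ∀ v, ∑ w, @ite _ (G.Adj v w) (Classical.propDecidable _) (f w) 0 = x * f v := by
    intro f
    rw [funext_iff]
    refine forall_congr' fun v => ?_
    simp only [Matrix.toLin'_apply, Matrix.mulVec, dotProduct, SimpleGraph.adjMatrix_apply,
      ite_mul, one_mul, zero_mul, Pi.smul_apply, smul_eq_mul]
    congr!
  constructor
  · rintro ⟨f, hf, h⟩
    exact Module.End.hasEigenvalue_of_hasEigenvector
      (x := f) ⟨Module.End.mem_eigenspace_iff.2 ((key f).2 h), hf⟩
  · intro h
    obtain ⟨f, hf, h0⟩ := h.exists_hasEigenvector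
    exact ⟨f, h0, (key f).1 (Module.End.mem_eigenspace_iff.1 hf)⟩

/-- A decreasing family of reals that is invariant as a multiset under negation is antisymmetric
under reversal. -/
theorem Antitone.apply_rev_eq_neg {n : ℕ} {f : Fin n → ℝ} (hf : Antitone f)
    (h : Multiset.map f Finset.univ.val = Multiset.map (fun i => -f i) Finset.univ.val)
    (i : Fin n) : f i.rev = -f i := by
  have hg : Antitone fun i : Fin n => -f i.rev :=
    fun i j hij => neg_le_neg (hf (Fin.rev_le_rev.2 hij))
  have hrev : Multiset.map (fun i => -f i) (Finset.univ : Finset (Fin n)).val =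
      Multiset.map (fun i : Fin n => -f i.rev) Finset.univ.val := by
    have := Multiset.map_univ_val_equiv (Fin.revPerm (n := n))
    conv_lhs => rw [← this]
    rw [Multiset.map_map]
    rfl
  rw [hrev, Fin.univ_val_map, Fin.univ_val_map, Multiset.coe_eq_coe] at h
  -- Two decreasing lists that are permutations of each other coincide.
  have := List.ofFn_injective (h.eq_of_sortedGE hf.sortedGE_ofFn hg.sortedGE_ofFn)
  have := congrFun this i
  linarith

open Polynomial in
/-- The roots of the characteristic polynomial of a Hermitian matrix that is conjugate to its
negative by a diagonal sign matrix are invariant under negation. -/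
theorem Matrix.IsHermitian.map_eigenvalues₀_eq_map_neg {n : Type*} [Fintype n] [DecidableEq n]
    {A : Matrix n n ℝ} (hA : A.IsHermitian) (ε : n → ℝ) (hε : ∀ i, ε i * ε i = 1)
    (h : ∀ i j, ε i * A i j * ε j = -A i j) :
    Multiset.map hA.eigenvalues₀ Finset.univ.val =
      Multiset.map (fun i => -hA.eigenvalues₀ i) Finset.univ.val := by
  have h1 : Matrix.diagonal ε * A * Matrix.diagonal ε = -A := by
    ext i j
    simp [h i j]
  have h2 : (-A).charpoly = A.charpoly := by
    rw [← h1, Matrix.charpoly_mul_comm, ← mul_assoc, Matrix.diagonal_mul_diagonal]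
    simp [hε]
  have h3 : (-A).charpoly = ∏ i, (X - C (-hA.eigenvalues i)) := by
    have e : -A = Unitary.conjStarAlgAut ℝ _ hA.eigenvectorUnitary
        (Matrix.diagonal fun i => -hA.eigenvalues i) := by
      conv_lhs => rw [hA.spectral_theorem]
      rw [← map_neg, Matrix.diagonal_neg]
      rfl
    rw [e, Unitary.conjStarAlgAut_apply, Matrix.charpoly_mul_comm, ← mul_assoc]
    simp [Matrix.charpoly_diagonal]
  have h4 : (-A).charpoly.roots = Multiset.map (fun i => -hA.eigenvalues i) Finset.univ.val := by
    rw [h3, Polynomial.roots_prod]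
    · simp
    · exact Finset.prod_ne_zero_iff.2 fun i _ => Polynomial.X_sub_C_ne_zero _
  have h5 : Multiset.map (fun i => -hA.eigenvalues i) Finset.univ.val =
      Multiset.map (fun i => -hA.eigenvalues₀ i) Finset.univ.val := by
    conv_rhs => rw [← Multiset.map_univ_val_equiv
      (Fintype.equivOfCardEq (Fintype.card_fin (Fintype.card n))).symm, Multiset.map_map]
    rfl
  have h6 := hA.roots_charpoly_eq_eigenvalues₀
  rw [← h5, ← h4, h2, h6]
  rfl

/-- Bounds on the HL-index of a bipartite graph of even order in terms of its eigenvalues. -/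
theorem hlIndex_mem_Ioo {V : Type*} [Fintype V] [Nonempty V] (G : SimpleGraph V)
    (hG : G.IsBipartite) (hV : Even (Fintype.card V)) {lo hi x : ℝ}
    (hlo : ∀ y, IsAdjEigenvalue G y → lo < |y|) (hx : IsAdjEigenvalue G x) (hx0 : 0 < x)
    (hxhi : x < hi) : lo < hlIndex G ∧ hlIndex G < hi := by
  classical
  obtain ⟨m, hm⟩ := hV
  have hm0 : 0 < m := by
    have := Fintype.card_pos (α := V)
    omega
  have hA : (G.adjMatrix ℝ).IsHermitian := G.isHermitian_adjMatrix ℝ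
  obtain ⟨c⟩ := hG
  have hrev : ∀ i, hA.eigenvalues₀ i.rev = -hA.eigenvalues₀ i := by
    refine hA.eigenvalues₀_antitone.apply_rev_eq_neg
      (hA.map_eigenvalues₀_eq_map_neg (fun v => if c v = 0 then 1 else -1) ?_ ?_)
    · intro v
      split_ifs <;> simp
    · intro v w
      simp only [SimpleGraph.adjMatrix_apply]
      by_cases hvw : G.Adj v w
      · have := c.valid hvw
        split_ifs <;> first | (exfalso; omega) | simp
      · simp [hvw]
  have f1 : ⌊((Fintype.card V : ℚ) + 1) / 2⌋₊ = m := by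
    rw [Nat.floor_eq_iff (by positivity), hm]
    push_cast
    constructor <;> linarith
  have f2 : ⌈((Fintype.card V : ℚ) + 1) / 2⌉₊ = m + 1 := by
    rw [Nat.ceil_eq_iff (by omega), hm, Nat.add_sub_cancel]
    push_cast
    constructor <;> linarith
  -- `eigenvalues₀` counts from zero, so `i` carries the `m`-th eigenvalue and `i.rev` the `(m +
  -- 1)`-th.
  set i : Fin (Fintype.card V) := ⟨m - 1, by omega⟩
  have e1 : graphEigenvalue G m = hA.eigenvalues₀ i := by
    unfold graphEigenvalue
    rw [dif_pos ⟨by omega, by omega⟩]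
  have e2 : graphEigenvalue G (m + 1) = -hA.eigenvalues₀ i := by
    rw [← hrev i]
    unfold graphEigenvalue
    rw [dif_pos ⟨by omega, by omega⟩]
    congr!
    simp [i, hm]
    omega
  have e3 : hlIndex G = |hA.eigenvalues₀ i| := by
    rw [hlIndex, f1, f2, e1, e2, abs_neg, max_self]
  have hi0 : 0 ≤ hA.eigenvalues₀ i := by
    have : hA.eigenvalues₀ i.rev ≤ hA.eigenvalues₀ i := by
      apply hA.eigenvalues₀_antitone
      rw [Fin.le_def, Fin.val_rev]
      simp [i]
      omega
    rw [hrev] at this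
    linarith
  refine ⟨?_, ?_⟩
  · rw [e3]
    exact hlo _ ((isAdjEigenvalue_iff_mem_range_eigenvalues₀ G hA _).2 ⟨i, rfl⟩)
  · rw [e3, abs_of_nonneg hi0]
    obtain ⟨j, hj⟩ := (isAdjEigenvalue_iff_mem_range_eigenvalues₀ G hA x).1 hx
    refine lt_of_le_of_lt ?_ hxhi
    rw [← hj]
    refine hA.eigenvalues₀_antitone ?_
    -- If `j` lay beyond `i`, then `x` would be at most the eigenvalue at `i.rev`, which is
    -- nonpositive.
    by_contra hij
    have : hA.eigenvalues₀ j ≤ hA.eigenvalues₀ i.rev := by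
      apply hA.eigenvalues₀_antitone
      rw [not_le, Fin.lt_def] at hij
      rw [Fin.le_def, Fin.val_rev]
      simp only [i] at hij ⊢
      omega
    rw [hrev, hj] at this
    linarith

/-! ### The resolvent of the incidence graph -/

section Plane

open Configuration Configuration.ProjectivePlane

variable {P L : Type*} [Fintype P] [Fintype L] [Membership P L] [ProjectivePlane P L]

open Classical in
theorem card_filter_mem_line (p : P) :
    (Finset.univ.filter fun l : L => p ∈ l).card = order P L + 1 := by
  rw [← lineCount_eq (L := L) p, lineCount, Nat.card_eq_fintype_card, Fintype.card_subtype]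

open Classical in
theorem card_filter_point_mem (l : L) :
    (Finset.univ.filter fun p : P => p ∈ l).card = order P L + 1 := by
  rw [← pointCount_eq P l, pointCount, Nat.card_eq_fintype_card, Fintype.card_subtype]

omit [Fintype P] in
open Classical in
theorem card_filter_mem_line_and_mem {p p' : P} (h : p ≠ p') :
    (Finset.univ.filter fun l : L => p ∈ l ∧ p' ∈ l).card = 1 := by
  obtain ⟨l, hl, hu⟩ := HasLines.existsUnique_line P L p p' h
  rw [Finset.card_eq_one]
  exact ⟨l, by ext l'; simpa using ⟨fun h => hu l' h, fun h => h ▸ hl⟩⟩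

open Classical in
/-- The collinearity identity `N Nᵀ = q I + J` for the incidence matrix of a projective plane. -/
theorem sum_line_sum_point (F : P → ℝ) (p : P) :
    ∑ l : L, (if p ∈ l then ∑ p', (if p' ∈ l then F p' else 0) else 0) =
      order P L * F p + ∑ p', F p' := by
  have h1 : ∀ p', ∑ l : L, (if p ∈ l then (if p' ∈ l then F p' else 0) else 0) =
      (if p' = p then order P L * F p else 0) + F p' := by
    intro p'
    simp_rw [← ite_and]
    rw [← Finset.sum_filter, Finset.sum_const, nsmul_eq_mul]
    split_ifs with h
    · subst h
      simp only [and_self]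
      rw [card_filter_mem_line]
      push_cast
      ring
    · rw [card_filter_mem_line_and_mem (Ne.symm h)]
      simp
  calc _ = ∑ l : L, ∑ p', (if p ∈ l then (if p' ∈ l then F p' else 0) else 0) := by
        refine Finset.sum_congr rfl fun l _ => ?_
        split_ifs <;> simp
    _ = _ := by
        rw [Finset.sum_comm, Finset.sum_congr rfl fun p' _ => h1 p', Finset.sum_add_distrib]
        simp

open Classical in
theorem sum_point_sum_line (H : L → ℝ) :
    ∑ p : P, ∑ l, (if p ∈ l then H l else 0) = (order P L + 1) * ∑ l, H l := by
  rw [Finset.sum_comm, Finset.mul_sum]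
  refine Finset.sum_congr rfl fun l _ => ?_
  rw [← Finset.sum_filter, Finset.sum_const, nsmul_eq_mul, card_filter_point_mem]
  push_cast
  rfl

/-- `(F, H)` solves the resolvent equation `(x - A) (F, H) = α e_p + β e_l` for the adjacency
operator `A` of the incidence graph of a projective plane. -/
structure IsResolventSolution (p : P) (l : L) (x α β : ℝ) (F : P → ℝ) (H : L → ℝ) : Prop where
  point (p' : P) : open Classical in
    x * F p' = ∑ l', (if p' ∈ l' then H l' else 0) + if p' = p then α else 0
  line (l' : L) : open Classical in
    x * H l' = ∑ p', (if p' ∈ l' then F p' else 0) + if l' = l then β else 0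

namespace IsResolventSolution

variable {p : P} {l : L} {x α β : ℝ} {F : P → ℝ} {H : L → ℝ}

omit [ProjectivePlane P L] in
-- Duality swaps the two equations, so each result about lines follows from the one about points.
theorem dual (h : IsResolventSolution p l x α β F H) :
    IsResolventSolution (P := Dual L) (L := Dual P) l p x β α H F where
  point := h.line
  line := h.point

theorem sum_point (h : IsResolventSolution p l x α β F H) :
    x * ∑ p', F p' = (order P L + 1) * ∑ l', H l' + α := by
  classical
  rw [Finset.mul_sum, Finset.sum_congr rfl fun p' _ => h.point p', Finset.sum_add_distrib,
    Finset.sum_ite_eq' Finset.univ p, if_pos (Finset.mem_univ _), ← sum_point_sum_line]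

theorem sum_line (h : IsResolventSolution p l x α β F H) :
    x * ∑ l', H l' = (order P L + 1) * ∑ p', F p' + β := by
  have := h.dual.sum_point
  rwa [Dual.order] at this

/-- Multiplying the point equation by `x` and inserting the line equations produces `N Nᵀ = q I +
J`. -/
theorem apply_point (h : IsResolventSolution p l x α β F H) (p' : P) : open Classical in
    (x ^ 2 - order P L) * F p' =
      ∑ p'', F p'' + (if p' ∈ l then β else 0) + if p' = p then x * α else 0 := by
  classical
  have h1 : x * (x * F p') = ∑ l', (if p' ∈ l' then x * H l' else 0) +
      if p' = p then x * α else 0 := by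
    rw [h.point p', mul_add, Finset.mul_sum]
    simp only [mul_ite, mul_zero]
  have h2 : ∑ l', (if p' ∈ l' then x * H l' else 0) =
      order P L * F p' + ∑ p'', F p'' + if p' ∈ l then β else 0 := by
    rw [← sum_line_sum_point (L := L)]
    have : (if p' ∈ l then β else 0) = ∑ l', (if p' ∈ l' then (if l' = l then β else 0) else 0) := by
      rw [Finset.sum_eq_single l]
      · simp
      · intro l' _ hl'
        simp [hl']
      · simp
    rw [this, ← Finset.sum_add_distrib]
    refine Finset.sum_congr rfl fun l' _ => ?_
    rw [h.line l']
    split_ifs <;> simp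
  linarith

theorem apply_base_point (h : IsResolventSolution p l x α β F H) (hpl : p ∈ l) :
    (x ^ 2 - order P L) * F p = ∑ p'', F p'' + x * α + β := by
  rw [h.apply_point p, if_pos hpl, if_pos rfl]
  ring

theorem apply_base_line (h : IsResolventSolution p l x α β F H) (hpl : p ∈ l) :
    (x ^ 2 - order P L) * H l = ∑ l'', H l'' + x * β + α := by
  have := h.dual.apply_base_point hpl
  rwa [Dual.order] at this

/-- The bound on `x²` excludes the eigenvalues `±(q + 1)` and `±√q`: the first exclusion kills the
total sum, the second each value. -/
theorem point_eq_zero (h : IsResolventSolution p l x 0 0 F H) (hx : x ^ 2 < order P L) (p' : P) :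
    F p' = 0 := by
  have hq : (1 : ℝ) < order P L := by exact_mod_cast one_lt_order P L
  have h1 := h.sum_point
  have h2 := h.sum_line
  have h3 : (x ^ 2 - (order P L + 1) ^ 2) * ∑ p', F p' = 0 := by linear_combination x * h1 +
    (order P L + 1) * h2
  have h4 : ∑ p', F p' = 0 := (mul_eq_zero.1 h3).resolve_left (by nlinarith)
  have h5 := h.apply_point p'
  simp only [h4, mul_zero, ite_self, add_zero] at h5
  exact (mul_eq_zero.1 h5).resolve_left (by linarith)

theorem line_eq_zero (h : IsResolventSolution p l x 0 0 F H) (hx : x ^ 2 < order P L) (l' : L) :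
    H l' = 0 :=
  h.dual.point_eq_zero (by rwa [Dual.order]) l'

/-- The diagonal entry of the resolvent of the incidence graph of a projective plane of order `q`. -/
noncomputable def diagResolvent (q x : ℝ) : ℝ :=
  x * (1 + 1 / (x ^ 2 - (q + 1) ^ 2)) / (x ^ 2 - q)

/-- The entry at a flag of the resolvent of the incidence graph of a projective plane of order
`q`. -/
noncomputable def flagResolvent (q x : ℝ) : ℝ :=
  (1 + (q + 1) / (x ^ 2 - (q + 1) ^ 2)) / (x ^ 2 - q)

/-- The two total sums satisfy a 2×2 linear system with determinant `x² - (q + 1)²`; solving it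
removes the sum from `apply_base_point`. -/
theorem base_point_eq (h : IsResolventSolution p l x α β F H) (hpl : p ∈ l)
    (hx : x ^ 2 < order P L) :
    F p = diagResolvent (order P L) x * α + flagResolvent (order P L) x * β := by
  have hq : (1 : ℝ) < order P L := by exact_mod_cast one_lt_order P L
  have h1 := h.sum_point
  have h2 := h.sum_line
  have h3 := h.apply_base_point hpl
  generalize (order P L : ℝ) = q at *
  have n1 : x ^ 2 - q ≠ 0 := by linarith
  have n2 : x ^ 2 - (q + 1) ^ 2 ≠ 0 := by nlinarith
  have h4 : ∑ p', F p' = (x * α + (q + 1) * β) / (x ^ 2 - (q + 1) ^ 2) := by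
    rw [eq_div_iff n2]
    linear_combination x * h1 + (q + 1) * h2
  rw [h4] at h3
  have h5 : F p = ((x * α + (q + 1) * β) / (x ^ 2 - (q + 1) ^ 2) + x * α + β) / (x ^ 2 - q) := by
    rw [eq_div_iff n1, ← h3]
    ring
  rw [h5, diagResolvent, flagResolvent]
  field_simp
  ring

theorem base_line_eq (h : IsResolventSolution p l x α β F H) (hpl : p ∈ l)
    (hx : x ^ 2 < order P L) :
    H l = flagResolvent (order P L) x * α + diagResolvent (order P L) x * β := by
  have := h.dual.base_point_eq hpl (by rwa [Dual.order])
  rw [Dual.order] at this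
  rw [this, add_comm]

end IsResolventSolution

/-! ### The cubic governing the spectral gap -/

/-- The characteristic polynomial of the quotient of the incidence graph of a projective plane of
order `q`, signed by `-1` on one flag, by its partition around that flag. -/
def signedFlagPoly (q x : ℝ) : ℝ := x ^ 3 - (q - 1) * x ^ 2 - 3 * q * x + q ^ 2 - q

theorem signedFlagPoly_pos {q x : ℝ} (hq : 2 ≤ q) (hx : |x| ≤ √(q - 1) - 1) :
    0 < signedFlagPoly q x := by
  have hr2 : √(q - 1) ^ 2 = q - 1 := Real.sq_sqrt (by linarith)
  have hr1 : 1 ≤ √(q - 1) := Real.one_le_sqrt.2 (by linarith)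
  generalize √(q - 1) = r at *
  obtain rfl : q = r ^ 2 + 1 := by linarith
  obtain ⟨w, rfl⟩ : ∃ w, r = w + 1 := ⟨r - 1, by ring⟩
  rw [abs_le] at hx
  -- The cubic takes the value 2 at `w = √(q - 1) - 1`, and its increment from `w` to `x` is
  -- divisible by `w - x`.
  have e : signedFlagPoly ((w + 1) ^ 2 + 1) x = 2 + (w - x) * (3 * ((w + 1) ^ 2 + 1) -
      (x ^ 2 + x * w + w ^ 2) + (w + 1) ^ 2 * (w + x)) := by
    unfold signedFlagPoly
    ring
  rw [e]
  have h1 : x ^ 2 ≤ w ^ 2 := by nlinarith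
  have h2 : x * w ≤ w ^ 2 := by nlinarith
  have h3 : 0 ≤ (w + 1) ^ 2 * (w + x) := mul_nonneg (sq_nonneg _) (by linarith)
  have h4 : 0 ≤ (w - x) * (3 * ((w + 1) ^ 2 + 1) -
      (x ^ 2 + x * w + w ^ 2) + (w + 1) ^ 2 * (w + x)) :=
    mul_nonneg (by linarith) (by nlinarith)
  linarith

theorem exists_signedFlagPoly_eq_zero {q : ℝ} (hq : 2 ≤ q) :
    ∃ x, 0 < x ∧ x < √q - 1 ∧ signedFlagPoly q x = 0 := by
  have hs2 : √q ^ 2 = q := Real.sq_sqrt (by linarith)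
  have hs1 : 1 < √q := by
    rw [Real.lt_sqrt (by norm_num)]
    linarith
  have h0 : 0 < signedFlagPoly q 0 := by
    unfold signedFlagPoly
    nlinarith
  have h1 : signedFlagPoly q (√q - 1) < 0 := by
    have : signedFlagPoly q (√q - 1) = -(√q * (√q - 1)) := by
      unfold signedFlagPoly
      linear_combination (√q - q - 1) * hs2
    rw [this]
    nlinarith
  have hc : ContinuousOn (signedFlagPoly q) (Set.Icc 0 (√q - 1)) := by
    unfold signedFlagPoly
    fun_prop
  obtain ⟨x, ⟨hx1, hx2⟩, hx⟩ := intermediate_value_Ioo' (by linarith) hc ⟨h1, h0⟩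
  exact ⟨x, hx1, hx2, hx⟩

open IsResolventSolution in
-- The quantity is the difference of squares `(1 + 2τ)² - (2ρ)²`, and its two factors are the cubic
-- at `-x` and at `x` over positive denominators.
theorem one_add_four_mul_resolvent_pos {q x : ℝ} (hq : 2 ≤ q) (hx : |x| ≤ √(q - 1) - 1) :
    0 < 1 + 4 * (flagResolvent q x + flagResolvent q x ^ 2 - diagResolvent q x ^ 2) := by
  have h1 := signedFlagPoly_pos hq hx
  have h2 := signedFlagPoly_pos (x := -x) hq (by rwa [abs_neg])
  have hr2 : √(q - 1) ^ 2 = q - 1 := Real.sq_sqrt (by linarith)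
  have hr0 := Real.sqrt_nonneg (q - 1)
  have hxq : x ^ 2 < q := by
    rw [← sq_abs]
    nlinarith [abs_nonneg x]
  have hx' := abs_lt.1 (abs_lt_of_sq_lt_sq (a := x) (b := q + 1) (by nlinarith) (by linarith))
  have n1 : 0 < q - x ^ 2 := by linarith
  have n2 : 0 < q + 1 - x := by linarith
  have n3 : 0 < q + 1 + x := by linarith
  have e : 1 + 4 * (flagResolvent q x + flagResolvent q x ^ 2 - diagResolvent q x ^ 2) =
      (signedFlagPoly q (-x) / ((q + 1 + x) * (q - x ^ 2))) *
        (signedFlagPoly q x / ((q + 1 - x) * (q - x ^ 2))) := by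
    have m1 : x ^ 2 - q ≠ 0 := by linarith
    have m2 : x ^ 2 - (q + 1) ^ 2 ≠ 0 := by nlinarith
    have e1 : 1 + 2 * flagResolvent q x - 2 * diagResolvent q x =
        signedFlagPoly q (-x) / ((q + 1 + x) * (q - x ^ 2)) := by
      rw [eq_div_iff (by positivity)]
      unfold flagResolvent diagResolvent signedFlagPoly
      field_simp
      ring
    have e2 : 1 + 2 * flagResolvent q x + 2 * diagResolvent q x =
        signedFlagPoly q x / ((q + 1 - x) * (q - x ^ 2)) := by
      rw [eq_div_iff (by positivity)]
      unfold flagResolvent diagResolvent signedFlagPoly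
      field_simp
      ring
    rw [← e1, ← e2]
    ring
  rw [e]
  positivity

end Plane

/-! ### The perturbed Laplace equation of a permutation -/

/-- The two coordinates of a solution of the rank-two resolvent equation for a permutation `σ`
satisfy a perturbed Laplace equation for `σ`, which has no nonzero solutions. -/
theorem eq_zero_of_resolvent_recurrence {ι : Type*} [Fintype ι] (σ : Equiv.Perm ι) {ρ τ : ℝ}
    (hκ : 0 < 1 + 4 * (τ + τ ^ 2 - ρ ^ 2)) {u v : ι → ℝ}
    (hu : ∀ i, u i = ρ * (v (σ i) - v i) + τ * (u (σ⁻¹ i) - u i))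
    (hv : ∀ i, v i = τ * (v (σ i) - v i) + ρ * (u (σ⁻¹ i) - u i)) (i : ι) : u i = 0 := by
  have h1 : ∀ i, u i + (τ + τ ^ 2 - ρ ^ 2) * (2 * u i - u (σ i) - u (σ⁻¹ i)) = 0 := by
    intro i
    have a1 := hu i
    have a2 := hu (σ i)
    have b1 := hv i
    have b2 := hv (σ i)
    rw [show σ⁻¹ (σ i) = i from σ.symm_apply_apply i] at a2 b2
    linear_combination (1 + τ) * a1 - τ * a2 + ρ * b2 - ρ * b1
  generalize τ + τ ^ 2 - ρ ^ 2 = κ at *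
  have h2 : ∑ i, u (σ i) ^ 2 = ∑ i, u i ^ 2 := Equiv.sum_comp σ fun i => u i ^ 2
  have h3 : ∑ i, u i * u (σ⁻¹ i) = ∑ i, u i * u (σ i) := by
    rw [← Equiv.sum_comp σ]
    simp [mul_comm]
  -- With `U = ∑ u²` and `D` the Dirichlet sum `∑ (u - u ∘ σ)²`, these two inequalities say `0 ≤ D ≤
  -- 4 U`.
  have h4 : 0 ≤ ∑ i, (u i - u (σ i)) ^ 2 := Finset.sum_nonneg fun i _ => sq_nonneg _
  have h5 : 0 ≤ ∑ i, (u i + u (σ i)) ^ 2 := Finset.sum_nonneg fun i _ => sq_nonneg _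
  have h6 : ∑ i, u i * (u i + κ * (2 * u i - u (σ i) - u (σ⁻¹ i))) = 0 :=
    Finset.sum_eq_zero fun i _ => by rw [h1, mul_zero]
  have e4 : ∑ i, (u i - u (σ i)) ^ 2 = 2 * ∑ i, u i ^ 2 - 2 * ∑ i, u i * u (σ i) := by
    rw [two_mul (∑ i, u i ^ 2)]
    nth_rw 2 [← h2]
    rw [Finset.mul_sum, ← Finset.sum_add_distrib, ← Finset.sum_sub_distrib]
    exact Finset.sum_congr rfl fun i _ => by ring
  have e5 : ∑ i, (u i + u (σ i)) ^ 2 = 2 * ∑ i, u i ^ 2 + 2 * ∑ i, u i * u (σ i) := by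
    rw [two_mul (∑ i, u i ^ 2)]
    nth_rw 2 [← h2]
    rw [Finset.mul_sum, ← Finset.sum_add_distrib, ← Finset.sum_add_distrib]
    exact Finset.sum_congr rfl fun i _ => by ring
  have e6 : ∑ i, u i * (u i + κ * (2 * u i - u (σ i) - u (σ⁻¹ i))) =
      ∑ i, u i ^ 2 + κ * (2 * ∑ i, u i ^ 2 - 2 * ∑ i, u i * u (σ i)) := by
    have : 2 * ∑ i, u i ^ 2 - 2 * ∑ i, u i * u (σ i) =
        2 * ∑ i, u i ^ 2 - ∑ i, u i * u (σ i) - ∑ i, u i * u (σ⁻¹ i) := by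
      rw [h3]
      ring
    rw [this, Finset.mul_sum, ← Finset.sum_sub_distrib, ← Finset.sum_sub_distrib, Finset.mul_sum,
      ← Finset.sum_add_distrib]
    exact Finset.sum_congr rfl fun i _ => by ring
  rw [e4] at h4
  rw [e5] at h5
  rw [e6] at h6
  have h7 : ∑ i, u i ^ 2 = 0 := by
    generalize ∑ i, u i ^ 2 = U at *
    generalize ∑ i, u i * u (σ i) = C at *
    -- Since `κ D = -U`, the left side is `D - 4 U`. Hence `D = 0`, and then `U = 0`.
    have h8 : (1 + 4 * κ) * (2 * U - 2 * C) ≤ 0 := by nlinarith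
    have h9 : 2 * U - 2 * C = 0 := le_antisymm (by by_contra! hh; nlinarith [mul_pos hκ hh]) h4
    rw [h9] at h6
    linarith
  have := (Finset.sum_eq_zero_iff_of_nonneg fun i _ => sq_nonneg (u i)).1 h7 i (Finset.mem_univ i)
  exact pow_eq_zero_iff two_ne_zero |>.1 this

/-! ### An explicit resolvent solution at a root of the cubic -/

section ResolventSolution

open Configuration Configuration.ProjectivePlane

variable {P L : Type*} [Fintype P] [Fintype L] [Membership P L] [ProjectivePlane P L]

open Classical in
/-- The eigenvalue equation at the point `p'` for an explicit solution with `α = β = -2`. -/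
theorem flagWave_point_eq (p p' : P) {l : L} (hpl : p ∈ l) {x s : ℝ}
    (hs : s * (order P L + 1 - x) = 2) (hxq : x ^ 2 < order P L) :
    x * ((s - (if p' ∈ l then 2 else 0) - if p' = p then 2 * x else 0) / (x ^ 2 - order P L)) =
      ∑ l', (if p' ∈ l' then
        (s - (if p ∈ l' then 2 else 0) - if l' = l then 2 * x else 0) / (x ^ 2 - order P L) else 0) +
        if p' = p then -2 else 0 := by
  have n1 : x ^ 2 - (order P L : ℝ) ≠ 0 := by linarith
  have h1 : ∑ l' : L, (if p' ∈ l' then s else 0) = (order P L + 1) * s := by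
    rw [← Finset.sum_filter, Finset.sum_const, card_filter_mem_line, nsmul_eq_mul]
    push_cast
    rfl
  have h2 : ∑ l' : L, (if p' ∈ l' then (if p ∈ l' then (2 : ℝ) else 0) else 0) =
      2 + if p' = p then 2 * (order P L : ℝ) else 0 := by
    simp_rw [← ite_and]
    rw [← Finset.sum_filter, Finset.sum_const, nsmul_eq_mul]
    split_ifs with h
    · subst h
      simp only [and_self]
      rw [card_filter_mem_line]
      push_cast
      ring
    · rw [card_filter_mem_line_and_mem h]
      simp
  have h3 : ∑ l' : L, (if p' ∈ l' then (if l' = l then 2 * x else 0) else 0) =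
      if p' ∈ l then 2 * x else 0 := by
    rw [Finset.sum_eq_single l]
    · simp
    · intro l' _ hl'
      simp [hl']
    · simp
  have h4 : ∑ l', (if p' ∈ l' then
        (s - (if p ∈ l' then 2 else 0) - if l' = l then 2 * x else 0) / (x ^ 2 - order P L) else 0) =
      ((order P L + 1) * s - (2 + if p' = p then 2 * (order P L : ℝ) else 0) -
        if p' ∈ l then 2 * x else 0) / (x ^ 2 - order P L) := by
    rw [← h1, ← h2, ← h3, ← Finset.sum_sub_distrib, ← Finset.sum_sub_distrib, Finset.sum_div]
    refine Finset.sum_congr rfl fun l' _ => ?_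
    split_ifs <;> simp
  rw [h4]
  field_simp
  by_cases h5 : p' = p
  · subst h5
    simp only [if_pos hpl, if_true]
    linear_combination -hs
  · simp only [if_neg h5]
    split_ifs <;> linear_combination -hs

/-- The sources are `-2` because an alternating sign jumps by `-2` times itself between sheets. The
formula is the one forced by `apply_point`, with `s` the common total over points and over lines;
the value 1 on the flag is equivalent to the vanishing of the cubic. -/
theorem exists_isResolventSolution_neg_two {p : P} {l : L} (hpl : p ∈ l) {x : ℝ}
    (hx : signedFlagPoly (order P L) x = 0) (hxq : x ^ 2 < order P L) :
    ∃ (F : P → ℝ) (H : L → ℝ), F p = 1 ∧ H l = 1 ∧ IsResolventSolution p l x (-2) (-2) F H := by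
  classical
  have hq : (1 : ℝ) < order P L := by exact_mod_cast one_lt_order P L
  have hx' := abs_lt.1 (abs_lt_of_sq_lt_sq (a := x) (b := order P L + 1) (by nlinarith)
    (by linarith))
  have n1 : x ^ 2 - (order P L : ℝ) ≠ 0 := by linarith
  have n2 : (order P L : ℝ) + 1 - x ≠ 0 := by linarith
  obtain ⟨s, hs⟩ : ∃ s, s * ((order P L : ℝ) + 1 - x) = 2 := ⟨2 / (order P L + 1 - x), by field_simp⟩
  have hval : (s - 2 - 2 * x) / (x ^ 2 - order P L) = 1 := by
    rw [div_eq_one_iff_eq n1]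
    refine mul_right_cancel₀ n2 ?_
    unfold signedFlagPoly at hx
    linear_combination hs + hx
  refine ⟨_, _, ?_, ?_, fun p' => flagWave_point_eq p p' hpl hs hxq, fun l' => ?_⟩
  · simpa [hpl] using hval
  · simpa [hpl] using hval
  · have := flagWave_point_eq (P := Dual L) (L := Dual P) l l' (l := p) hpl (x := x) (s := s)
      (by rwa [Dual.order]) (by rwa [Dual.order])
    rw [Dual.order] at this
    exact this

end ResolventSolution

/-! ### Lifts over one flag and their spectrum -/

section FlagLift

open Configuration Configuration.ProjectivePlane

variable {P L : Type*} [Membership P L] {m : ℕ}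

/-- `G` is the `m`-lift of the incidence graph whose voltage is `σ` on the flag `(p, l)`, oriented
from the point to the line, and trivial on the other flags. -/
structure IsFlagLift (G : SimpleGraph ((P ⊕ L) × Fin m)) (p : P) (l : L)
    (σ : Equiv.Perm (Fin m)) : Prop where
  mem : p ∈ l
  not_adj_point (p₁ p₂ : P) (i j : Fin m) : ¬ G.Adj (Sum.inl p₁, i) (Sum.inl p₂, j)
  not_adj_line (l₁ l₂ : L) (i j : Fin m) : ¬ G.Adj (Sum.inr l₁, i) (Sum.inr l₂, j)
  adj_iff (p' : P) (l' : L) (i j : Fin m) : open Classical in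
    G.Adj (Sum.inl p', i) (Sum.inr l', j) ↔
      p' ∈ l' ∧ (if p' = p ∧ l' = l then σ else 1) i = j

/-- The edge `ab` may run from line to point; read from the point, its voltage is then the inverse
rotation. -/
theorem cyclicLift_isFlagLift {a b : P ⊕ L} (hab : (incidenceGraph P L).Adj a b) :
    ∃ (p : P) (l : L) (σ : Equiv.Perm (Fin m)), (σ = finRotate m ∨ σ = (finRotate m)⁻¹) ∧
      IsFlagLift (cyclicLift (incidenceGraph P L) a b hab m) p l σ := by
  have key := hab
  obtain ⟨p, l, rfl, rfl, h⟩ | ⟨p, l, rfl, rfl, h⟩ := key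
  · refine ⟨p, l, _, Or.inl rfl, h, ?_, ?_, ?_⟩ <;>
      simp [cyclicLift, VoltageAssignment.lift, incidenceGraph, cyclicVoltage]
    intros
    congr! 5
    · exact Sum.inl_injective.eq_iff
    · exact Sum.inr_injective.eq_iff
  · refine ⟨p, l, _, Or.inr rfl, h, ?_, ?_, ?_⟩ <;>
      simp [cyclicLift, VoltageAssignment.lift, incidenceGraph, cyclicVoltage]
    intros
    congr! 5
    · exact Sum.inl_injective.eq_iff
    · exact Sum.inr_injective.eq_iff

namespace IsFlagLift

variable {G : SimpleGraph ((P ⊕ L) × Fin m)} {p : P} {l : L} {σ : Equiv.Perm (Fin m)}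

theorem adj_of_ne (h : IsFlagLift G p l σ) {p' : P} {l' : L} (hm : p' ∈ l')
    (hne : ¬ (p' = p ∧ l' = l)) (i : Fin m) : G.Adj (Sum.inl p', i) (Sum.inr l', i) := by
  rw [h.adj_iff, if_neg hne]
  exact ⟨hm, rfl⟩

theorem isBipartite (h : IsFlagLift G p l σ) : G.IsBipartite := by
  refine ⟨SimpleGraph.Coloring.mk (fun x => Sum.elim (fun _ => (0 : Fin 2)) (fun _ => 1) x.1) ?_⟩
  rintro ⟨p₁ | l₁, i⟩ ⟨p₂ | l₂, j⟩ hadj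
  · exact absurd hadj (h.not_adj_point _ _ _ _)
  · simp
  · simp
  · exact absurd hadj (h.not_adj_line _ _ _ _)

section Sums

variable [Fintype P] [Fintype L]

open Classical in
-- The lift is a disjoint union of copies of the plane with one flag rewired, so its operator
-- differs from the sheetwise one only at `p` and `l`.
theorem sum_adj_point (h : IsFlagLift G p l σ) (f : (P ⊕ L) × Fin m → ℝ) (p' : P) (i : Fin m) :
    ∑ w, (if G.Adj (Sum.inl p', i) w then f w else 0) =
      ∑ l', (if p' ∈ l' then f (Sum.inr l', i) else 0) +
        if p' = p then f (Sum.inr l, σ i) - f (Sum.inr l, i) else 0 := by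
  have h1 : (if p' = p then f (Sum.inr l, σ i) - f (Sum.inr l, i) else 0) =
      ∑ l', if p' = p ∧ l' = l then f (Sum.inr l, σ i) - f (Sum.inr l, i) else 0 := by
    simp [ite_and]
  rw [h1, ← Finset.sum_add_distrib, Fintype.sum_prod_type, Fintype.sum_sum_type]
  simp only [h.not_adj_point, h.adj_iff, if_false, Finset.sum_const_zero, zero_add]
  refine Finset.sum_congr rfl fun l' _ => ?_
  by_cases hs : p' = p ∧ l' = l
  · obtain ⟨rfl, rfl⟩ := hs
    simp [h.mem]
  · simp [hs, ite_and]

open Classical in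
theorem sum_adj_line (h : IsFlagLift G p l σ) (f : (P ⊕ L) × Fin m → ℝ) (l' : L) (i : Fin m) :
    ∑ w, (if G.Adj (Sum.inr l', i) w then f w else 0) =
      ∑ p', (if p' ∈ l' then f (Sum.inl p', i) else 0) +
        if l' = l then f (Sum.inl p, σ⁻¹ i) - f (Sum.inl p, i) else 0 := by
  have h1 : (if l' = l then f (Sum.inl p, σ⁻¹ i) - f (Sum.inl p, i) else 0) =
      ∑ p', if p' = p ∧ l' = l then f (Sum.inl p, σ⁻¹ i) - f (Sum.inl p, i) else 0 := by
    simp [ite_and]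
  rw [h1, ← Finset.sum_add_distrib, Fintype.sum_prod_type, Fintype.sum_sum_type]
  simp only [G.adj_comm (Sum.inr l', i), h.not_adj_line, h.adj_iff, if_false,
    Finset.sum_const_zero, add_zero]
  refine Finset.sum_congr rfl fun p' _ => ?_
  by_cases hs : p' = p ∧ l' = l
  · obtain ⟨rfl, rfl⟩ := hs
    simp [h.mem, ← Equiv.Perm.eq_inv_iff_eq]
  · simp [hs, ite_and]

end Sums

variable [Fintype P] [Fintype L] [ProjectivePlane P L]

theorem isKRegular (h : IsFlagLift G p l σ) : IsKRegular G (order P L + 1) := by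
  classical
  have key : ∀ v, (G.degree v : ℝ) = order P L + 1 := by
    rintro ⟨p' | l', i⟩
    · have := h.sum_adj_point (fun _ => 1) p' i
      rw [SimpleGraph.degree_eq_sum_if_adj]
      simp only [sub_self, ite_self, add_zero] at this
      rw [← Finset.sum_filter (fun l' => p' ∈ l'), Finset.sum_const, card_filter_mem_line] at this
      push_cast [nsmul_eq_mul, mul_one] at this
      rw [← this]
    · have := h.sum_adj_line (fun _ => 1) l' i
      rw [SimpleGraph.degree_eq_sum_if_adj]
      simp only [sub_self, ite_self, add_zero] at this
      rw [← Finset.sum_filter (fun p' => p' ∈ l'), Finset.sum_const, card_filter_point_mem] at this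
      push_cast [nsmul_eq_mul, mul_one] at this
      rw [← this]
  intro v
  exact_mod_cast key v

omit [ProjectivePlane P L] in
theorem isResolventSolution (h : IsFlagLift G p l σ) {f : (P ⊕ L) × Fin m → ℝ} {x : ℝ}
    (hf : ∀ v, ∑ w, (open Classical in if G.Adj v w then f w else 0) = x * f v) (i : Fin m) :
    IsResolventSolution p l x (f (Sum.inr l, σ i) - f (Sum.inr l, i))
      (f (Sum.inl p, σ⁻¹ i) - f (Sum.inl p, i)) (fun p' => f (Sum.inl p', i))
      (fun l' => f (Sum.inr l', i)) where
  point p' := by rw [← hf, h.sum_adj_point]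
  line l' := by rw [← hf, h.sum_adj_line]

theorem lt_abs_of_isAdjEigenvalue (h : IsFlagLift G p l σ) {x : ℝ} (hx : IsAdjEigenvalue G x) :
    √((order P L : ℝ) - 1) - 1 < |x| := by
  by_contra! hle
  obtain ⟨f, hf0, hf⟩ := hx
  have hq : (2 : ℝ) ≤ order P L := by exact_mod_cast one_lt_order P L
  have hr2 : √((order P L : ℝ) - 1) ^ 2 = order P L - 1 := Real.sq_sqrt (by linarith)
  have hxq : x ^ 2 < order P L := by
    rw [← sq_abs]
    nlinarith [abs_nonneg x, Real.sqrt_nonneg ((order P L : ℝ) - 1)]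
  have hpos := one_add_four_mul_resolvent_pos hq hle
  have sol := h.isResolventSolution hf
  have hu := fun i => (sol i).base_point_eq h.mem hxq
  have hv := fun i => (sol i).base_line_eq h.mem hxq
  have u0 := eq_zero_of_resolvent_recurrence σ hpos (u := fun i => f (Sum.inl p, i))
    (v := fun i => f (Sum.inr l, i)) hu hv
  -- The recurrence is symmetric under exchanging `u` with `v` and `σ` with `σ⁻¹`.
  have v0 := eq_zero_of_resolvent_recurrence σ⁻¹ hpos (u := fun i => f (Sum.inr l, i))
    (v := fun i => f (Sum.inl p, i)) (fun i => by rw [inv_inv, add_comm]; exact hv i)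
    (fun i => by rw [inv_inv, add_comm]; exact hu i)
  simp only [u0, v0, sub_zero] at sol
  refine hf0 (funext ?_)
  rintro ⟨p' | l', i⟩
  · exact (sol i).point_eq_zero hxq p'
  · exact (sol i).line_eq_zero hxq l'

/-- The eigenfunction is the explicit flag solution multiplied by the sign `ε` of the sheet. -/
theorem isAdjEigenvalue (h : IsFlagLift G p l σ) {ε : Fin m → ℝ} (hε : ε ≠ 0)
    (hσ : ∀ i, ε (σ i) = -ε i) {x : ℝ} (hx : signedFlagPoly (order P L) x = 0)
    (hxq : x ^ 2 < order P L) : IsAdjEigenvalue G x := by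
  classical
  have hσ' : ∀ i, ε (σ⁻¹ i) = -ε i := fun i => by
    have := hσ (σ⁻¹ i)
    rw [show σ (σ⁻¹ i) = i from σ.apply_symm_apply i] at this
    linarith
  have hq : (1 : ℝ) < order P L := by exact_mod_cast one_lt_order P L
  have hx' := abs_lt.1 (abs_lt_of_sq_lt_sq (a := x) (b := order P L + 1) (by nlinarith)
    (by linarith))
  obtain ⟨F, H, hF, hH, sol⟩ := exists_isResolventSolution_neg_two h.mem hx hxq
  refine ⟨fun w => ε w.2 * Sum.elim F H w.1, fun h0 => hε (funext fun i => ?_), ?_⟩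
  · simpa [hF] using congrFun h0 (Sum.inl p, i)
  · rintro ⟨p' | l', i⟩
    · rw [h.sum_adj_point]
      have := sol.point p'
      simp only [Sum.elim_inl, Sum.elim_inr, hσ, hH, ← mul_ite_zero, ← Finset.mul_sum]
      rw [mul_left_comm, this, mul_add]
      split_ifs <;> ring
    · rw [h.sum_adj_line]
      have := sol.line l'
      simp only [Sum.elim_inl, Sum.elim_inr, hσ', hF, ← mul_ite_zero, ← Finset.mul_sum]
      rw [mul_left_comm, this, mul_add]
      split_ifs <;> ring

end IsFlagLift

end FlagLift

/-! ### Connectedness of the lift -/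

section Connected

open Configuration Configuration.ProjectivePlane

variable {P L : Type*} [Finite P] [Finite L] [Membership P L] [ProjectivePlane P L]

theorem exists_mem_not_mem_of_line_ne {l l' : L} (h : l' ≠ l) : ∃ p : P, p ∈ l' ∧ p ∉ l := by
  classical
  have := Fintype.ofFinite P
  have := Fintype.ofFinite L
  by_contra! hall
  have h1 : 1 < (Finset.univ.filter fun p : P => p ∈ l').card := by
    rw [card_filter_point_mem]
    have := one_lt_order P L
    omega
  obtain ⟨p₁, h₁, p₂, h₂, hne⟩ := Finset.one_lt_card.1 h1
  simp only [Finset.mem_filter, Finset.mem_univ, true_and] at h₁ h₂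
  exact (Nondegenerate.eq_or_eq h₁ h₂ (hall _ h₁) (hall _ h₂)).elim hne h

theorem exists_mem_ne (p : P) (l : L) : ∃ p' : P, p' ∈ l ∧ p' ≠ p := by
  classical
  have := Fintype.ofFinite P
  have := Fintype.ofFinite L
  have h1 : 1 < (Finset.univ.filter fun p : P => p ∈ l).card := by
    rw [card_filter_point_mem]
    have := one_lt_order P L
    omega
  obtain ⟨p', h₁, hne⟩ := Finset.exists_mem_ne h1 p
  exact ⟨p', by simpa using h₁, hne⟩

theorem exists_line_mem_not_mem_of_ne {p p' : P} (h : p' ≠ p) : ∃ l : L, p' ∈ l ∧ p ∉ l :=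
  exists_mem_not_mem_of_line_ne (P := Dual L) (L := Dual P) h

variable {m : ℕ} {G : SimpleGraph ((P ⊕ L) × Fin m)} {p : P} {l : L} {σ : Equiv.Perm (Fin m)}

namespace IsFlagLift

omit [Finite P] [Finite L] in
-- The line joining `p'` to `p` differs from `l`, so the path avoids the rewired flag and stays in
-- its sheet.
theorem reachable_of_not_mem (h : IsFlagLift G p l σ) {p' : P} (hp' : p' ∉ l) (i : Fin m) :
    G.Reachable (Sum.inl p', i) (Sum.inl p, i) := by
  have hne : p' ≠ p := fun he => hp' (he ▸ h.mem)
  have hl := HasLines.mkLine_ax (L := L) hne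
  refine (h.adj_of_ne hl.1 (fun he => hne he.1) i).reachable.trans
    (h.adj_of_ne hl.2 (fun he => hp' ?_) i).symm.reachable
  exact he.2 ▸ hl.1

theorem reachable_line_of_not_mem (h : IsFlagLift G p l σ) {l' : L} (hl' : p ∉ l') (i : Fin m) :
    G.Reachable (Sum.inr l', i) (Sum.inl p, i) := by
  have hne : l' ≠ l := fun he => hl' (he ▸ h.mem)
  obtain ⟨p', hp', hp'l⟩ := exists_mem_not_mem_of_line_ne (P := P) hne
  exact (h.adj_of_ne hp' (fun he => hne he.2) i).symm.reachable.trans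
    (h.reachable_of_not_mem hp'l i)

theorem reachable_point (h : IsFlagLift G p l σ) (p' : P) (i : Fin m) :
    G.Reachable (Sum.inl p', i) (Sum.inl p, i) := by
  by_cases hne : p' = p
  · rw [hne]
  · obtain ⟨l', hp', hp⟩ := exists_line_mem_not_mem_of_ne (L := L) hne
    exact (h.adj_of_ne hp' (fun he => hne he.1) i).reachable.trans
      (h.reachable_line_of_not_mem hp i)

theorem reachable_line (h : IsFlagLift G p l σ) (l' : L) (i : Fin m) :
    G.Reachable (Sum.inr l', i) (Sum.inl p, i) := by
  obtain ⟨p', hp', hne⟩ := exists_mem_ne p l'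
  exact (h.adj_of_ne hp' (fun he => hne he.1) i).symm.reachable.trans (h.reachable_point p' i)

/-- Each sheet is connected without the flag edge, and the flag edges join sheet `i` to sheet `σ i`.
-/
theorem connected [NeZero m] (h : IsFlagLift G p l σ) (hσ : ∀ i j, ∃ n : ℕ, (σ ^ n) i = j) :
    G.Connected := by
  have hstep : ∀ i, G.Reachable (Sum.inl p, i) (Sum.inl p, σ i) := fun i =>
    (show G.Adj (Sum.inl p, i) (Sum.inr l, σ i) by simp [h.adj_iff, h.mem]).reachable.trans
      (h.reachable_line l (σ i))
  have hpow : ∀ (n : ℕ) i, G.Reachable (Sum.inl p, i) (Sum.inl p, (σ ^ n) i) := by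
    intro n i
    induction n with
    | zero => rfl
    | succ n ih =>
      rw [pow_succ', Equiv.Perm.mul_apply]
      exact ih.trans (hstep _)
  rw [SimpleGraph.connected_iff_exists_forall_reachable]
  refine ⟨(Sum.inl p, 0), ?_⟩
  rintro ⟨v, i⟩
  obtain ⟨n, rfl⟩ := hσ 0 i
  refine (hpow n 0).trans ?_
  rcases v with p' | l'
  · exact (h.reachable_point p' _).symm
  · exact (h.reachable_line l' _).symm

end IsFlagLift

end Connected

/-! ### The rotation, existence of planes and the final assembly -/

theorem finRotate_exists_pow_apply_eq {m : ℕ} (hm : 2 ≤ m) {σ : Equiv.Perm (Fin m)}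
    (hσ : σ = finRotate m ∨ σ = (finRotate m)⁻¹) (i j : Fin m) : ∃ n : ℕ, (σ ^ n) i = j := by
  have hmove : ∀ i, finRotate m i ≠ i := fun i => by
    rw [← Equiv.Perm.mem_support, support_finRotate_of_le hm]
    exact Finset.mem_univ i
  have hs := (isCycle_finRotate_of_le hm).sameCycle (hmove i) (hmove j)
  rcases hσ with rfl | rfl
  · exact hs.exists_nat_pow_eq
  · exact hs.inv.exists_nat_pow_eq

theorem neg_one_pow_finRotate {t : ℕ} (i : Fin (2 * t)) :
    (-1 : ℝ) ^ (finRotate (2 * t) i : ℕ) = -(-1) ^ (i : ℕ) := by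
  obtain ⟨n, hn⟩ : ∃ n, 2 * t = n + 1 := ⟨2 * t - 1, by have := i.2; omega⟩
  generalize hm : 2 * t = m at i hn ⊢
  subst hn
  rw [coe_finRotate]
  split_ifs with h
  · subst h
    -- At the wrap-around from `n = 2t - 1` to 0 the sign still flips, because the cycle has even
    -- length.
    have : Odd n := by
      rw [← Nat.not_even_iff_odd]
      rintro ⟨r, hr⟩
      omega
    simp [this.neg_one_pow]
  · rw [pow_succ]
    ring

theorem neg_one_pow_of_finRotate {t : ℕ} {σ : Equiv.Perm (Fin (2 * t))}
    (hσ : σ = finRotate (2 * t) ∨ σ = (finRotate (2 * t))⁻¹) (i : Fin (2 * t)) :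
    (-1 : ℝ) ^ (σ i : ℕ) = -(-1) ^ (i : ℕ) := by
  rcases hσ with rfl | rfl
  · exact neg_one_pow_finRotate i
  · have := neg_one_pow_finRotate ((finRotate (2 * t))⁻¹ i)
    rw [show finRotate (2 * t) ((finRotate (2 * t))⁻¹ i) = i from
      (finRotate (2 * t)).apply_symm_apply i] at this
    rw [this, neg_neg]

open Configuration Configuration.ProjectivePlane in
/-- Every graph isomorphic to an even cyclic lift, over one edge, of the incidence graph of a
projective plane of order `q` has HL-index strictly between `√(q-1) - 1` and `√q - 1`. -/
theorem hasLargeHLIndex_of_iso_cyclicLift {P L : Type*} [Fintype P] [Fintype L] [Membership P L]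
    [ProjectivePlane P L] {a b : P ⊕ L} (hab : (incidenceGraph P L).Adj a b) {t : ℕ} (ht : 1 ≤ t)
    {W : Type*} [Fintype W] {H : SimpleGraph W}
    (e : H ≃g cyclicLift (incidenceGraph P L) a b hab (2 * t)) :
    HasLargeHLIndex H (order P L + 1) := by
  classical
  obtain ⟨p, l, σ, hσ, h⟩ := cyclicLift_isFlagLift (m := 2 * t) hab
  have : NeZero (2 * t) := ⟨by omega⟩
  have hconn := h.connected (finRotate_exists_pow_apply_eq (by omega) hσ)
  have hbip : H.IsBipartite := h.isBipartite.of_hom e.toHom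
  have hreg : IsKRegular H (order P L + 1) := fun v => by
    rw [← e.degree_eq v]
    convert h.isKRegular (e v)
  have hconn' : H.Connected := e.connected_iff.2 hconn
  have hcard : Even (Fintype.card W) := by
    rw [Fintype.card_congr e.toEquiv, Fintype.card_prod, Fintype.card_fin]
    exact (even_two_mul t).mul_left _
  have := hconn'.nonempty
  have hq : (2 : ℝ) ≤ order P L := by exact_mod_cast one_lt_order P L
  obtain ⟨x, hx0, hx1, hx⟩ := exists_signedFlagPoly_eq_zero hq
  have hxq : x ^ 2 < order P L := by
    have := Real.sq_sqrt (show (0 : ℝ) ≤ order P L by linarith)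
    nlinarith
  have heig : IsAdjEigenvalue H x := (h.isAdjEigenvalue (ε := fun i => (-1) ^ (i : ℕ))
    (fun h0 => by simpa using congrFun h0 0) (neg_one_pow_of_finRotate hσ) hx hxq).of_iso e.symm
  have hbounds := hlIndex_mem_Ioo H hbip hcard
    (fun y hy => h.lt_abs_of_isAdjEigenvalue (hy.of_iso e)) heig hx0 hx1
  refine ⟨hconn', hbip, hreg, ?_, ?_⟩
  · convert hbounds.1 using 3
    push_cast
    ring
  · convert hbounds.2 using 3
    push_cast
    ring

open Configuration Configuration.ProjectivePlane in
/-- There is a projective plane of every prime power order. -/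
theorem exists_projectivePlane_of_isPrimePow {q : ℕ} (hq : IsPrimePow q) :
    ∃ (P L : Type) (_ : Fintype P) (_ : Fintype L) (_ : Membership P L) (_ : ProjectivePlane P L),
      order P L = q := by
  classical
  obtain ⟨p, n, hp, hn, rfl⟩ := hq
  have : Fact p.Prime := ⟨hp.nat_prime⟩
  let K := GaloisField p n
  let S := Projectivization K (Fin 3 → K)
  have : Finite S := inferInstance
  have hS : Fintype S := Fintype.ofFinite S
  refine ⟨S, S, hS, hS, inferInstanceAs (Membership S S), inferInstanceAs (ProjectivePlane S S), ?_⟩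
  -- Counting the points in two ways gives `order² + order + 1 = q² + q + 1`, which determines the
  -- order.
  have h1 := card_points S S
  rw [← Nat.card_eq_fintype_card, Projectivization.card_of_finrank K (Fin 3 → K) (n := 3) (by simp),
    GaloisField.card p n hn.ne'] at h1
  simp only [Finset.sum_range_succ, Finset.sum_range_zero] at h1
  change order S S = p ^ n
  generalize p ^ n = q at h1
  nlinarith

open Configuration Configuration.ProjectivePlane in
theorem incidenceGraph_exists_adj (P L : Type*) [Membership P L] [ProjectivePlane P L] :
    ∃ a b, (incidenceGraph P L).Adj a b := by
  obtain ⟨p₁, p₂, p₃, l₁, l₂, l₃, -, -, -, h, -⟩ := exists_config (P := P) (L := L)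
  exact ⟨Sum.inl p₂, Sum.inr l₂, Or.inl ⟨p₂, l₂, rfl, rfl, h⟩⟩

theorem theorem4p2 (k : ℕ) (hk : IsPrimePow (k - 1)) :
    (∃ (n : ℕ → ℕ) (G : (i : ℕ) → SimpleGraph (Fin (n i))),
      (∀ i j, i ≠ j → IsEmpty (G i ≃g G j)) ∧
      ∀ i, HasLargeHLIndex (G i) k ∧ IsCyclicLiftOfPlane (G i) (k - 1)) ∧
    (∀ (P L : Type*) [Fintype P] [Fintype L] [Membership P L]
      [Configuration.ProjectivePlane P L],
      Configuration.ProjectivePlane.order P L = k - 1 →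
      ∀ (a b : P ⊕ L) (hab : (incidenceGraph P L).Adj a b) (t : ℕ), 1 ≤ t →
        HasLargeHLIndex (cyclicLift (incidenceGraph P L) a b hab (2 * t)) k) := by
  -- A prime power is at least 2, so the truncated subtraction is harmless.
  have hk1 : k - 1 + 1 = k := by
    have := hk.two_le
    omega
  constructor
  · obtain ⟨P, L, iP, iL, iM, iPL, hord⟩ := exists_projectivePlane_of_isPrimePow hk
    obtain ⟨a, b, hab⟩ := incidenceGraph_exists_adj P L
    let V : ℕ → Type := fun i => (P ⊕ L) × Fin (2 * (i + 1))
    let e : ∀ i, V i ≃ Fin (Fintype.card (V i)) := fun i => Fintype.equivFin (V i)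
    let f : ∀ i, (cyclicLift (incidenceGraph P L) a b hab (2 * (i + 1))).map (e i).toEmbedding ≃g
        cyclicLift (incidenceGraph P L) a b hab (2 * (i + 1)) :=
      fun i => (SimpleGraph.Iso.map (e i) _).symm
    refine ⟨fun i => Fintype.card (V i), fun i =>
      (cyclicLift (incidenceGraph P L) a b hab (2 * (i + 1))).map (e i).toEmbedding, ?_, ?_⟩
    · intro i j hij
      refine ⟨fun g => hij ?_⟩
      -- Different members of the family have different numbers of vertices.
      have h1 := Fintype.card_congr g.toEquiv
      have h2 : 0 < Fintype.card (P ⊕ L) := Fintype.card_pos_iff.2 ⟨a⟩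
      simp only [V, Fintype.card_fin, Fintype.card_prod] at h1
      have := Nat.eq_of_mul_eq_mul_left h2 h1
      omega
    · intro i
      refine ⟨?_, P, L, iP, iL, iM, iPL, a, b, hab, 2 * (i + 1), hord, by omega, ⟨f i⟩⟩
      rw [← hk1, ← hord]
      exact hasLargeHLIndex_of_iso_cyclicLift hab (by omega) (f i)
  · intro P L _ _ _ _ hord a b hab t ht
    rw [← hk1, ← hord]
    exact hasLargeHLIndex_of_iso_cyclicLift hab ht SimpleGraph.Iso.refl
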